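/- Theorem (overlap distribution of the $M/M/\infty$ queue). Let $\lambda,\mu>0$ and consider an $M/M/\infty$ queue that is empty at time $0$: customers $j=1,2,\dots$ arrive at the times $0<A_1<A_2<\cdots$ of a Poisson process with rate $\lambda$ (the interarrival times $A_1,A_2-A_1,\dots$ are i.i.d. exponential with rate $\lambda$), with counting process $N(t)=\#\{j: A_j\le t\}$; customer $j$ has service time $S_j$, and leaves at time $A_j+S_j$. Let $\mathcal S$ be the service time of a further customer who arrives at time $t\ge 0$. The variables $S_1,S_2,\dots,\mathcal S$ are exponential with rate $\mu$, and $(A_{j+1}-A_j)_{j\ge0}$ (with $A_0=0$), $(S_j)_{j\ge1}$, $\mathcal S$ are all mutually independent. Let $$Q^\infty(t)=\sum_{j=1}^{N(t)}\mathbf 1\{A_j<t<A_j+S_j\},\qquad q^\infty(t)=\mathbb E[Q^\infty(t)],$$ and let $$O(t)=N(t+\mathcal S)-N(t)+Q^\infty(t)$$ be the number of customers with whom the customer arriving at time $t$ overlaps. Put $\rho=\frac{\lambda}{\lambda+\mu}$ and $\Gamma(a,x)=\int_x^\infty s^{a-1}e^{-s}\,ds$. Then for every $t\ge0$: 1. $q^\infty(t)=\frac{\lambda}{\mu}\left(1-e^{-\mu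 t}\right)$ and, for every integer $k\ge0$, $$\mathbb P(O(t)=k)=\rho^k(1-\rho)\,e^{\frac{\mu}{\lambda}q^\infty(t)}\,\frac{\Gamma\!\left(k+1,\frac{\lambda+\mu}{\lambda}q^\infty(t)\right)}{\Gamma(k+1)}.$$ 2. $O(t)$ is square integrable, with $$\mathbb E[O(t)]=\frac{\lambda}{\mu}\left(2-e^{-\mu t}\right),\qquad \operatorname{Var}[O(t)]=\frac{\lambda^2}{\mu^2}+\frac{\lambda}{\mu}\left(2-e^{-\mu t}\right).$$ 3. $O(t)\stackrel{D}{=}X+Y$, where $X$ and $Y$ are independent, $\mathbb P(X=k)=(1-\rho)\rho^k$ for $k\ge0$ (geometric with parameter $\rho$), and $Y$ is Poisson with mean $q^\infty(t)$. -/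

import Mathlib

open MeasureTheory ProbabilityTheory

noncomputable section

namespace MMInfty

/-- The upper incomplete gamma function `Γ(a, x) = ∫_x^∞ s^(a-1) e^(-s) ds`. -/
def upperGamma (a x : ℝ) : ℝ := ∫ s in Set.Ioi x, s ^ (a - 1) * Real.exp (-s)

/-- The primitive random variables of an M/M/∞ queue that is empty at time `0`, together with a
tagged customer: the interarrival times `T 0, T 1, …` are exponential with rate `lam` (so that the
arrivals form a Poisson process of rate `lam` on `[0, ∞)`), the service times `S 0, S 1, …` of the
arriving customers and the service time `S'` of the tagged customer are exponential with rate `mu`,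
and all of these random variables are independent. -/
structure IsQueue {Ω : Type*} [MeasurableSpace Ω] (P : Measure Ω) (lam mu : ℝ)
    (T S : ℕ → Ω → ℝ) (S' : Ω → ℝ) : Prop where
  measurable_interarrival : ∀ j, Measurable (T j)
  measurable_service : ∀ j, Measurable (S j)
  measurable_tagged : Measurable S'
  law_interarrival : ∀ j, HasLaw (T j) (expMeasure lam) P
  law_service : ∀ j, HasLaw (S j) (expMeasure mu) P
  law_tagged : HasLaw S' (expMeasure mu) P
  indep : iIndepFun (Sum.elim T (Sum.elim S (fun _ : Unit => S'))) P

variable {Ω : Type*}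

/-- The arrival time of customer `j`; customers are numbered from `0`. -/
def arrivalTime (T : ℕ → Ω → ℝ) (j : ℕ) (ω : Ω) : ℝ := ∑ i ∈ Finset.range (j + 1), T i ω

/-- The arrival counting process `N(t)`: the number of arrivals up to and including time `t`
(almost surely finite). -/
def arrivals (T : ℕ → Ω → ℝ) (t : ℝ) (ω : Ω) : ℕ := Set.ncard {j : ℕ | arrivalTime T j ω ≤ t}

/-- The queue length `Q(t)`: how many of the first `N(t)` customers satisfy
`A_j < t < A_j + S_j`. -/
def queueLength (T S : ℕ → Ω → ℝ) (t : ℝ) (ω : Ω) : ℕ :=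
  ∑ j ∈ Finset.range (arrivals T t ω),
    if arrivalTime T j ω < t ∧ t < arrivalTime T j ω + S j ω then 1 else 0

/-- The number `O(t) = N(t + S') - N(t) + Q(t)` of customers overlapping with a tagged customer who
arrives at time `t` with service time `S'`. Almost surely `S' ≥ 0` and `N` is finite, so the
subtraction does not truncate. -/
def overlap (T S : ℕ → Ω → ℝ) (S' : Ω → ℝ) (t : ℝ) (ω : Ω) : ℕ :=
  (arrivals T (t + S' ω) ω - arrivals T t ω) + queueLength T S t ω

/-- The mean queue length `q(t) = E[Q(t)]`. -/
def meanQueueLength [MeasurableSpace Ω] (P : Measure Ω) (T S : ℕ → Ω → ℝ) (t : ℝ) : ℝ :=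
  ∫ ω, (queueLength T S t ω : ℝ) ∂P

/-- The ratio `ρ = lam / (lam + mu)` as a point of the unit interval. -/
def ratio {lam mu : ℝ} (hlam : 0 < lam) (hmu : 0 < mu) : unitInterval :=
  ⟨lam / (lam + mu), by positivity, by rw [div_le_one (by positivity)]; linarith⟩

/-- The geometric distribution on `{0, 1, 2, …}` with `P(k) = (1 - ρ) ρ ^ k`; its success
probability is `1 - ρ`. -/
def geometricLaw (ρ : unitInterval) : Measure ℕ := geometricMeasure (unitInterval.symm ρ)

end MMInfty

end

/-! ### Moments, characteristic functions and convolutions of Poisson and geometric laws. -/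

section Moments

open Finset

/-! Everything follows from the joint generating function `IsQueue.integral_pow_mul_pow`: for
complex z, w in the closed unit disc, E[z^Q(t) w^(N(t+S')-N(t))] = exp(q(z-1)) · mu/(mu + lam(1-w)),
with q = (lam/mu)(1 - e^(-mu t)). The factors are the generating functions of a Poisson and of a
geometric law. Taking z = w = e^(iθ) yields the characteristic function of O(t), and w = 1 that of
Q(t).

The generating function comes from a martingale over the customers instead of from properties of the
Poisson process. Fix S' = s. A customer arriving at a contributes a random factor with mean m(a),
and H(a) = exp(-lam ∫_a^∞ (1 - m)) is the expected product of all factors after a. Since H' = lam(1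
- m)H, conditioning on the next arrival gives H(a) = E[m(a+T)H(a+T)] for T exponential of rate lam
(`integral_meanWeight_mul_futureWeight`). Hence the product of the first n factors times H at the
n-th arrival has an expectation independent of n (`IsQueue.integral_state`). Arrivals tend to
infinity almost surely and H = 1 from t + s on, so letting n → ∞ gives E[H(0)], a Laplace transform
in S'.

The mass function is then a finite convolution, matched with Γ(k+1, x) = k! e^(-x) Σ_{j≤k} x^j/j!;
mean and variance add over the two summands. -/

theorem MMInfty.upperGamma_natCast_add_one (k : ℕ) {x : ℝ} (hx : 0 ≤ x) :
    MMInfty.upperGamma ((k : ℝ) + 1) x =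
      k.factorial * Real.exp (-x) * ∑ j ∈ range (k + 1), x ^ j / j.factorial := by
  have key : ∀ s : ℝ, HasDerivAt
      (fun s => -(k.factorial * Real.exp (-s) * ∑ j ∈ range (k + 1), s ^ j / j.factorial))
      (s ^ k * Real.exp (-s)) s := by
    intro s
    -- Differentiating a truncated exponential series drops its top term, so in the product rule
    -- with e^(-s) only the degree k term survives.
    have h1 : HasDerivAt (fun s : ℝ => ∑ j ∈ range (k + 1), s ^ j / j.factorial)
        (∑ j ∈ range k, s ^ j / j.factorial) s := by
      have : ∀ j ∈ range (k + 1), HasDerivAt (fun s : ℝ => s ^ j / j.factorial)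
          (j * s ^ (j - 1) / j.factorial) s := fun j _ => (hasDerivAt_pow j s).div_const _
      convert! HasDerivAt.fun_sum this using 1
      rw [sum_range_succ']
      simp only [Nat.cast_zero, zero_mul, zero_div, add_zero, Nat.add_sub_cancel]
      refine sum_congr rfl fun j _ => ?_
      rw [Nat.factorial_succ]
      push_cast
      have : (j.factorial : ℝ) ≠ 0 := by positivity
      field_simp
    have h2 : HasDerivAt (fun s : ℝ => Real.exp (-s)) (-Real.exp (-s)) s := by
      simpa using (hasDerivAt_neg s).exp
    convert! ((h2.const_mul (k.factorial : ℝ)).mul h1).neg using 1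
    rw [sum_range_succ]
    have : (k.factorial : ℝ) ≠ 0 := by positivity
    field_simp
    ring
  have hlim : Filter.Tendsto
      (fun s : ℝ => -(k.factorial * Real.exp (-s) * ∑ j ∈ range (k + 1), s ^ j / j.factorial))
      Filter.atTop (nhds 0) := by
    have : Filter.Tendsto (fun s : ℝ => -(k.factorial * ∑ j ∈ range (k + 1),
        (s ^ j * Real.exp (-s)) / j.factorial)) Filter.atTop
        (nhds (-(k.factorial * ∑ j ∈ range (k + 1), 0 / (j.factorial : ℝ)))) :=
      ((tendsto_finsetSum _ fun j _ =>
        (Real.tendsto_pow_mul_exp_neg_atTop_nhds_zero j).div_const _).const_mul _).neg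
    simp only [zero_div, sum_const_zero, mul_zero, neg_zero] at this
    refine this.congr fun s => ?_
    rw [mul_assoc (k.factorial : ℝ), mul_sum (range (k + 1)) _ (Real.exp (-s))]
    congr 2
    exact sum_congr rfl fun j _ => by ring
  have := integral_Ioi_of_hasDerivAt_of_nonneg' (a := x) (fun s _ => key s)
    (fun s hs => mul_nonneg (pow_nonneg (hx.trans (le_of_lt hs)) _) (Real.exp_pos _).le) hlim
  simp only [MMInfty.upperGamma, add_sub_cancel_right, Real.rpow_natCast]
  rw [this]
  ring

/-- The factorial moments of the Poisson distribution. -/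
theorem hasSum_descFactorial_mul_poisson (r : ℝ) (m : ℕ) :
    HasSum (fun n : ℕ => Real.exp (-r) * r ^ n / n.factorial * (n.descFactorial m : ℝ)) (r ^ m) := by
  have h0 : HasSum (fun n : ℕ => Real.exp (-r) * r ^ n / n.factorial) 1 := by
    have := (NormedSpace.expSeries_div_hasSum_exp r).mul_left (Real.exp (-r))
    rw [← Real.exp_eq_exp_ℝ, ← Real.exp_add, neg_add_cancel, Real.exp_zero] at this
    simpa only [mul_div_assoc] using this
  -- The terms with n < m vanish; after the shift by m the falling factorial cancels part of the
  -- factorial, leaving r^m times the total mass.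
  rw [← hasSum_nat_add_iff' m]
  have hz : ∑ i ∈ range m, Real.exp (-r) * r ^ i / i.factorial * (i.descFactorial m : ℝ) = 0 :=
    sum_eq_zero fun i hi => by
      rw [Nat.descFactorial_of_lt (mem_range.1 hi), Nat.cast_zero, mul_zero]
  rw [hz, sub_zero]
  convert! h0.mul_left (r ^ m) using 1
  · funext n
    have : ((n + m).factorial : ℝ) = n.factorial * (n + m).descFactorial m := by
      rw [← Nat.factorial_mul_descFactorial (Nat.le_add_left m n), Nat.add_sub_cancel]
      push_cast; ring
    have h1 : ((n + m).factorial : ℝ) ≠ 0 := by positivity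
    have h2 : (n.factorial : ℝ) ≠ 0 := by positivity
    have h3 : ((n + m).descFactorial m : ℝ) ≠ 0 := fun h => h1 (by rw [this, h, mul_zero])
    rw [this, pow_add]
    field_simp
  · ring

/-- The factorial moments of the geometric distribution. -/
theorem hasSum_descFactorial_mul_geometric {p : unitInterval} (hp : p ≠ 0) (m : ℕ) :
    HasSum (fun n : ℕ => (1 - p : ℝ) ^ n * p * (n.descFactorial m : ℝ))
      (m.factorial * ((1 - p) / p) ^ m) := by
  have hp0 : (0 : ℝ) < p := unitInterval.pos_iff_ne_zero.2 hp
  have hn : ‖(1 - p : ℝ)‖ < 1 := by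
    rw [Real.norm_of_nonneg (by linarith [p.2.2])]; linarith
  rw [← hasSum_nat_add_iff' m]
  have hz : ∑ i ∈ range m, (1 - p : ℝ) ^ i * p * (i.descFactorial m : ℝ) = 0 :=
    sum_eq_zero fun i hi => by
      rw [Nat.descFactorial_of_lt (mem_range.1 hi), Nat.cast_zero, mul_zero]
  rw [hz, sub_zero]
  convert! (hasSum_choose_mul_geometric_of_norm_lt_one m hn).mul_left
    (m.factorial * (1 - p : ℝ) ^ m * p) using 1
  · funext n
    rw [Nat.descFactorial_eq_factorial_mul_choose, pow_add]
    push_cast; ring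
  · rw [sub_sub_cancel, div_pow, pow_succ]
    field_simp

/-- Uses n² = n(n-1) + n. The weights `w` are abstract so that the Poisson and geometric laws share
one computation. -/
theorem memLp_two_mean_variance_of_factorial_moments {ν : Measure ℕ} [IsProbabilityMeasure ν]
    {w : ℕ → ℝ}
    (hint : ∀ f : ℕ → ℝ, Integrable f ν ↔ Summable (fun n => w n * ‖f n‖))
    (hsum : ∀ f : ℕ → ℝ, ∫ n, f n ∂ν = ∑' n, w n • f n) {a b : ℝ}
    (h1 : HasSum (fun n => w n * (n.descFactorial 1 : ℝ)) a)
    (h2 : HasSum (fun n => w n * (n.descFactorial 2 : ℝ)) b) :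
    MemLp (fun n : ℕ => (n : ℝ)) 2 ν ∧ ∫ n, (n : ℝ) ∂ν = a ∧
      variance (fun n : ℕ => (n : ℝ)) ν = b + a - a ^ 2 := by
  have hsq : HasSum (fun n : ℕ => w n * ((n : ℝ) ^ 2)) (b + a) := by
    convert! h2.add h1 using 1
    funext n
    rw [← mul_add]
    congr 1
    rcases n with _ | n
    · simp
    · simp [Nat.descFactorial_succ]; ring
  have hL : MemLp (fun n : ℕ => (n : ℝ)) 2 ν := by
    rw [memLp_two_iff_integrable_sq (by fun_prop), hint]
    simpa using hsq.summable
  have hm : ∫ n, (n : ℝ) ∂ν = a := by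
    rw [hsum]
    simpa using h1.tsum_eq
  refine ⟨hL, hm, ?_⟩
  rw [variance_eq_sub hL, hm]
  have : ∫ n, (n : ℝ) ^ 2 ∂ν = b + a := by
    rw [hsum]; exact hsq.tsum_eq
  simpa using this

theorem poissonMeasure_memLp_mean_variance (r : NNReal) :
    MemLp (fun n : ℕ => (n : ℝ)) 2 (poissonMeasure r) ∧ ∫ n, (n : ℝ) ∂(poissonMeasure r) = r ∧
      variance (fun n : ℕ => (n : ℝ)) (poissonMeasure r) = r := by
  have := memLp_two_mean_variance_of_factorial_moments (ν := poissonMeasure r)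
    (w := fun n => Real.exp (-r) * (r : ℝ) ^ n / n.factorial)
    (fun f => integrable_poissonMeasure_iff) (fun f => integral_poissonMeasure r f)
    (hasSum_descFactorial_mul_poisson r 1) (hasSum_descFactorial_mul_poisson r 2)
  refine ⟨this.1, by simpa using this.2.1, this.2.2.trans (by ring)⟩

theorem geometricMeasure_memLp_mean_variance {p : unitInterval} (hp : p ≠ 0) :
    MemLp (fun n : ℕ => (n : ℝ)) 2 (geometricMeasure p) ∧
      ∫ n, (n : ℝ) ∂(geometricMeasure p) = (1 - p) / p ∧
      variance (fun n : ℕ => (n : ℝ)) (geometricMeasure p) =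
        ((1 - p : ℝ) / p) ^ 2 + (1 - p) / p := by
  have := memLp_two_mean_variance_of_factorial_moments (ν := geometricMeasure p)
    (w := fun n => (1 - p : ℝ) ^ n * p)
    (fun f => integrable_geometricMeasure_iff hp) (fun f => integral_geometricMeasure hp f)
    (hasSum_descFactorial_mul_geometric hp 1) (hasSum_descFactorial_mul_geometric hp 2)
  refine ⟨this.1, by simpa using this.2.1, this.2.2.trans (by norm_num [Nat.factorial]; ring)⟩

theorem charFun_map_cast_geometricMeasure {p : unitInterval} (hp : p ≠ 0) (θ : ℝ) :
    charFun ((geometricMeasure p).map (Nat.cast : ℕ → ℝ)) θ =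
      p / (1 - (1 - p) * Complex.exp (θ * Complex.I)) := by
  have hp0 : (0 : ℝ) < p := unitInterval.pos_iff_ne_zero.2 hp
  have hn : ‖(1 - p : ℂ) * Complex.exp (θ * Complex.I)‖ < 1 := by
    rw [norm_mul, Complex.norm_exp_ofReal_mul_I, mul_one]
    have : (1 - p : ℂ) = ((1 - p : ℝ) : ℂ) := by push_cast; rfl
    rw [this, Complex.norm_real, Real.norm_of_nonneg (by linarith [p.2.2])]
    linarith
  rw [charFun_apply_real, integral_map .of_discrete (by fun_prop), integral_geometricMeasure hp]
  refine HasSum.tsum_eq ?_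
  convert! (hasSum_geometric_of_norm_lt_one hn).mul_left (p : ℂ) using 1
  funext n
  rw [mul_pow, ← Complex.exp_nat_mul, Complex.real_smul]
  push_cast
  rw [show (θ * n * Complex.I : ℂ) = n * (θ * Complex.I) by ring]
  ring

theorem conv_nat_real_singleton (α β : Measure ℕ) [IsProbabilityMeasure α]
    [IsProbabilityMeasure β] (k : ℕ) :
    (α ∗ β).real {k} = ∑ ij ∈ antidiagonal k, α.real {ij.1} * β.real {ij.2} := by
  rw [Measure.conv, map_measureReal_apply (by fun_prop) (.of_discrete)]
  have : (fun x : ℕ × ℕ => x.1 + x.2) ⁻¹' {k} = (antidiagonal k : Set (ℕ × ℕ)) := by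
    ext; simp
  rw [this, ← sum_measureReal_singleton]
  refine sum_congr rfl fun ij _ => ?_
  rw [← measureReal_prod_prod, Set.singleton_prod_singleton]

theorem conv_nat_memLp_mean_variance {α β : Measure ℕ} [IsProbabilityMeasure α]
    [IsProbabilityMeasure β] (hα : MemLp (fun n : ℕ => (n : ℝ)) 2 α)
    (hβ : MemLp (fun n : ℕ => (n : ℝ)) 2 β) :
    MemLp (fun n : ℕ => (n : ℝ)) 2 (α ∗ β) ∧
      ∫ n, (n : ℝ) ∂(α ∗ β) = ∫ n, (n : ℝ) ∂α + ∫ n, (n : ℝ) ∂β ∧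
      variance (fun n : ℕ => (n : ℝ)) (α ∗ β) =
        variance (fun n : ℕ => (n : ℝ)) α + variance (fun n : ℕ => (n : ℝ)) β := by
  have h1 : MemLp (fun x : ℕ × ℕ => (x.1 : ℝ)) 2 (α.prod β) := hα.comp_fst β
  have h2 : MemLp (fun x : ℕ × ℕ => (x.2 : ℝ)) 2 (α.prod β) := hβ.comp_snd α
  have hc : (fun n : ℕ => (n : ℝ)) ∘ (fun x : ℕ × ℕ => x.1 + x.2) =
      (fun x : ℕ × ℕ => (x.1 : ℝ)) + fun x => (x.2 : ℝ) := by
    ext; simp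
  have hind : IndepFun (fun x : ℕ × ℕ => (x.1 : ℝ)) (fun x => (x.2 : ℝ)) (α.prod β) :=
    indepFun_prod (X := fun n : ℕ => (n : ℝ)) (Y := fun n : ℕ => (n : ℝ)) (by fun_prop)
      (by fun_prop)
  refine ⟨?_, ?_, ?_⟩
  · rw [Measure.conv, memLp_map_measure_iff (by fun_prop) (by fun_prop), hc]
    exact h1.add h2
  · rw [Measure.conv, integral_map (by fun_prop) (by fun_prop)]
    simp only [Nat.cast_add]
    rw [integral_add (h1.integrable (by norm_num)) (h2.integrable (by norm_num)),
      integral_fun_fst (f := fun n : ℕ => (n : ℝ)), integral_fun_snd (f := fun n : ℕ => (n : ℝ))]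
    simp
  · rw [Measure.conv, variance_map (by fun_prop) (by fun_prop), hc, hind.variance_add h1 h2]
    congr 1
    · rw [← (measurePreserving_fst (μ := α) (ν := β)).map_eq,
        variance_map (by fun_prop) (by fun_prop), (measurePreserving_fst (μ := α) (ν := β)).map_eq]
      rfl
    · rw [← (measurePreserving_snd (μ := α) (ν := β)).map_eq,
        variance_map (by fun_prop) (by fun_prop), (measurePreserving_snd (μ := α) (ν := β)).map_eq]
      rfl

theorem MMInfty.symm_ratio_ne_zero {lam mu : ℝ} (hlam : 0 < lam) (hmu : 0 < mu) :
    unitInterval.symm (MMInfty.ratio hlam hmu) ≠ 0 := by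
  intro h
  have : (1 : ℝ) - lam / (lam + mu) = 0 := congrArg Subtype.val h
  have h2 : lam / (lam + mu) < 1 := by rw [div_lt_one (by positivity)]; linarith
  linarith

/-- With ρ = lam/(lam+mu), pulling ρ^k out of ρ^(k-j) q^j/j! leaves (q/ρ)^j/j!, a truncated
exponential series at q/ρ = ((lam+mu)/lam)q. The factor exp((mu/lam)q) turns the e^(-q/ρ) of the
incomplete gamma function into the Poisson e^(-q). -/
theorem geometric_conv_poisson_real_singleton {lam mu q : ℝ} (hlam : 0 < lam) (hmu : 0 < mu)
    (hq : 0 ≤ q) (k : ℕ) :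
    (MMInfty.geometricLaw (MMInfty.ratio hlam hmu) ∗ poissonMeasure q.toNNReal).real {k} =
      (lam / (lam + mu)) ^ k * (1 - lam / (lam + mu)) * Real.exp (mu / lam * q) *
        (MMInfty.upperGamma ((k : ℝ) + 1) ((lam + mu) / lam * q) / Real.Gamma ((k : ℝ) + 1)) := by
  have hs : ((unitInterval.symm (MMInfty.ratio hlam hmu) : unitInterval) : ℝ) =
    1 - lam / (lam + mu) := rfl
  have hk : (k.factorial : ℝ) ≠ 0 := by positivity
  have hexp : Real.exp (mu / lam * q) * Real.exp (-((lam + mu) / lam * q)) = Real.exp (-q) := by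
    rw [← Real.exp_add]
    congr 1
    field_simp
    ring
  rw [MMInfty.geometricLaw, conv_nat_real_singleton, MMInfty.upperGamma_natCast_add_one k (by positivity),
    Real.Gamma_nat_eq_factorial, mul_assoc, mul_div_right_comm, mul_div_cancel_left₀ _ hk,
    ← mul_assoc (Real.exp _), hexp, Nat.sum_antidiagonal_eq_sum_range_succ_mk, ← sum_range_reflect,
    mul_sum, mul_sum]
  refine sum_congr rfl fun j hj => ?_
  have hj' : j ≤ k := Nat.lt_succ_iff.1 (mem_range.1 hj)
  rw [geometricMeasure_real_singleton (MMInfty.symm_ratio_ne_zero hlam hmu),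
    poissonMeasure_real_singleton, Real.coe_toNNReal q hq, hs]
  simp only [sub_sub_cancel]
  obtain ⟨i, rfl⟩ := Nat.exists_eq_add_of_le hj'
  rw [show (j + i).succ - 1 - j = i by omega, Nat.add_sub_cancel, pow_add, mul_pow, div_pow, div_pow, div_pow]
  field_simp

end Moments

/-! ### Integrals against the exponential law. -/

section ExpMeasure

theorem integral_expMeasure {E : Type*} [NormedAddCommGroup E] [NormedSpace ℝ E] {r : ℝ}
    (hr : 0 < r) (f : ℝ → E) :
    ∫ x, f x ∂(expMeasure r) = ∫ x in Set.Ioi 0, (r * Real.exp (-(r * x))) • f x := by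
  have hm : Measurable (exponentialPDF r) :=
    (measurable_exponentialPDFReal r).ennreal_ofReal
  have h : expMeasure r = volume.withDensity (exponentialPDF r) := rfl
  rw [h, integral_withDensity_eq_integral_toReal_smul hm
    (.of_forall fun x => ENNReal.ofReal_lt_top), ← integral_Ici_eq_integral_Ioi,
    ← integral_indicator measurableSet_Ici]
  congr 1
  funext x
  by_cases hx : 0 ≤ x
  · rw [exponentialPDF_of_nonneg hx, Set.indicator_of_mem (Set.mem_Ici.2 hx),
      ENNReal.toReal_ofReal (by positivity)]
  · rw [exponentialPDF_of_neg (not_le.1 hx), Set.indicator_of_notMem (by simpa using hx)]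
    simp

theorem measureReal_expMeasure_Ioi {r x : ℝ} (hr : 0 < r) (hx : 0 ≤ x) :
    (expMeasure r).real (Set.Ioi x) = Real.exp (-(r * x)) := by
  have := isProbabilityMeasure_expMeasure hr
  rw [← Set.compl_Iic, measureReal_compl measurableSet_Iic, probReal_univ, ← cdf_eq_real,
    cdf_expMeasure_eq hr, if_pos hx]
  ring

theorem ae_nonneg_expMeasure {r : ℝ} (hr : 0 < r) : ∀ᵐ x ∂(expMeasure r), 0 ≤ x := by
  have := isProbabilityMeasure_expMeasure hr
  have h : (expMeasure r).real (Set.Ioi 0) = 1 := by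
    rw [measureReal_expMeasure_Ioi hr le_rfl]; simp
  have h' : ∀ᵐ x ∂(expMeasure r), x ∈ Set.Ioi (0 : ℝ) := by
    refine (mem_ae_iff_prob_eq_one measurableSet_Ioi).2 ?_
    rw [← ENNReal.toReal_eq_one_iff]
    exact h
  exact h'.mono fun x hx => le_of_lt hx

theorem integral_cexp_neg_mul_expMeasure {r : ℝ} (hr : 0 < r) {c : ℂ} (hc : 0 ≤ c.re) :
    ∫ x, Complex.exp (-(c * x)) ∂(expMeasure r) = r / (r + c) := by
  have hre : (-(r + c)).re < 0 := by simp; linarith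
  have hne : (r + c : ℂ) ≠ 0 := fun h => by rw [h] at hre; simp at hre
  rw [integral_expMeasure hr]
  have : ∀ x : ℝ, (r * Real.exp (-(r * x))) • Complex.exp (-(c * x)) =
      r * Complex.exp (-(r + c) * x) := fun x => by
    rw [Complex.real_smul]
    push_cast
    rw [mul_assoc, ← Complex.exp_add]
    congr 2
    ring
  simp only [this]
  rw [integral_const_mul, integral_exp_mul_complex_Ioi hre]
  simp only [Complex.ofReal_zero, mul_zero, Complex.exp_zero]
  field_simp

end ExpMeasure

/-! ### Weights of customers and the one-step identity at the next arrival. -/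

namespace MMInfty

/-- The factor contributed to `z ^ Q(t) * w ^ (N(t + s) - N(t))` by a customer who arrives at time
`a` and has service time `σ`. -/
noncomputable def weight (z w : ℂ) (t s a σ : ℝ) : ℂ :=
  (if a < t ∧ t < a + σ then z else 1) * (if t < a ∧ a ≤ t + s then w else 1)

/-- The mean of `weight` over an exponential service time. -/
noncomputable def meanWeight (mu : ℝ) (z w : ℂ) (t s a : ℝ) : ℂ :=
  if a < t then 1 - (1 - z) * Real.exp (-(mu * (t - a)))
  else if t < a ∧ a ≤ t + s then w else 1

/-- The integral of `1 - meanWeight` over `[a, ∞)`. -/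
noncomputable def deficit (mu : ℝ) (z w : ℂ) (t s a : ℝ) : ℂ :=
  (1 - z) * ((1 - Real.exp (-(mu * max (t - a) 0))) / mu : ℝ) +
    (1 - w) * (max (t + s - a) 0 - max (t - a) 0 : ℝ)

/-- The expected product of the weights of the customers arriving after time `a`. -/
noncomputable def futureWeight (lam mu : ℝ) (z w : ℂ) (t s a : ℝ) : ℂ :=
  Complex.exp (-(lam * deficit mu z w t s a))

variable {lam mu t s a : ℝ} {z w : ℂ}

theorem measurable_weight_comp {α : Type*} [MeasurableSpace α] {f g h : α → ℝ} (z w : ℂ) (t : ℝ)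
    (hf : Measurable f) (hg : Measurable g) (hh : Measurable h) :
    Measurable fun x => weight z w t (f x) (g x) (h x) := by
  unfold weight
  refine Measurable.mul (Measurable.ite ?_ measurable_const measurable_const)
    (Measurable.ite ?_ measurable_const measurable_const)
  · exact (measurableSet_lt hg measurable_const).inter
      (measurableSet_lt measurable_const (hg.add hh))
  · exact (measurableSet_lt measurable_const hg).inter
      (measurableSet_le hg (measurable_const.add hf))

theorem measurable_futureWeight_comp {α : Type*} [MeasurableSpace α] {f g : α → ℝ} (lam mu : ℝ)
    (z w : ℂ) (t : ℝ) (hf : Measurable f) (hg : Measurable g) :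
    Measurable fun x => futureWeight lam mu z w t (f x) (g x) := by
  unfold futureWeight deficit
  fun_prop

theorem continuous_futureWeight (lam mu : ℝ) (z w : ℂ) (t s : ℝ) :
    Continuous (futureWeight lam mu z w t s) := by
  unfold futureWeight deficit
  fun_prop

theorem norm_weight_le (hz : ‖z‖ ≤ 1) (hw : ‖w‖ ≤ 1) (t s a σ : ℝ) :
    ‖weight z w t s a σ‖ ≤ 1 := by
  unfold weight
  rw [norm_mul]
  exact mul_le_one₀ (by split_ifs <;> simp [hz]) (norm_nonneg _) (by split_ifs <;> simp [hw])

theorem one_sub_re_nonneg (hz : ‖z‖ ≤ 1) : 0 ≤ (1 - z).re := by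
  have := (Complex.re_le_norm z).trans hz
  simpa using this

theorem norm_futureWeight_le (hlam : 0 < lam) (hmu : 0 < mu) (hz : ‖z‖ ≤ 1) (hw : ‖w‖ ≤ 1)
    (hs : 0 ≤ s) (t a : ℝ) : ‖futureWeight lam mu z w t s a‖ ≤ 1 := by
  rw [futureWeight, Complex.norm_exp, Real.exp_le_one_iff, Complex.neg_re, neg_nonpos,
    Complex.re_ofReal_mul, deficit, Complex.add_re, Complex.re_mul_ofReal, Complex.re_mul_ofReal]
  have h1 : 0 ≤ (1 - Real.exp (-(mu * max (t - a) 0))) / mu := by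
    refine div_nonneg (sub_nonneg.2 (Real.exp_le_one_iff.2 ?_)) hmu.le
    have := le_max_right (t - a) 0
    simp only [Left.neg_nonpos_iff]
    positivity
  have h2 : 0 ≤ max (t + s - a) 0 - max (t - a) 0 :=
    sub_nonneg.2 (max_le_max (by linarith) le_rfl)
  have := one_sub_re_nonneg hz
  have := one_sub_re_nonneg hw
  positivity

theorem integral_weight (hmu : 0 < mu) (z w : ℂ) (t s a : ℝ) :
    ∫ σ, weight z w t s a σ ∂(expMeasure mu) = meanWeight mu z w t s a := by
  have := isProbabilityMeasure_expMeasure hmu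
  unfold meanWeight
  split_ifs with h1 h2
  -- A customer arriving before t is still present exactly when σ > t - a, which has probability
  -- e^(-mu(t-a)).
  · have : ∀ σ, weight z w t s a σ = 1 + (Set.Ioi (t - a)).indicator (fun _ => z - 1) σ := by
      intro σ
      by_cases h : t < a + σ
      · rw [Set.indicator_of_mem (by simp only [Set.mem_Ioi]; linarith)]
        simp [weight, h1, h, h1.not_gt]
      · rw [Set.indicator_of_notMem (by simp only [Set.mem_Ioi]; linarith)]
        simp [weight, h, h1.not_gt]
    simp only [this]
    rw [integral_add (integrable_const _)
      ((integrable_const _).indicator measurableSet_Ioi), integral_indicator_const _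
      measurableSet_Ioi, measureReal_expMeasure_Ioi hmu (by linarith), Complex.real_smul]
    simp
    ring
  · simp [weight, h1, h2]
  · simp [weight, h1, h2]

/-- `deficit` is a primitive of -(1 - `meanWeight`) on each of the three intervals cut out by t and
t + s; at these two points `meanWeight` may jump. -/
theorem hasDerivAt_futureWeight (hmu : 0 < mu) (hs : 0 ≤ s) (h1 : a ≠ t) (h2 : a ≠ t + s) :
    HasDerivAt (futureWeight lam mu z w t s)
      (lam * (1 - meanWeight mu z w t s a) * futureWeight lam mu z w t s a) a := by
  have key : HasDerivAt (deficit mu z w t s) (-(1 - meanWeight mu z w t s a)) a := by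
    rcases lt_or_gt_of_ne h1 with h | h
    · have hd : HasDerivAt (fun y => (1 - z) * ((1 - Real.exp (-(mu * (t - y)))) / mu : ℝ) +
          (1 - w) * (s : ℝ)) ((1 - z) * ((-(Real.exp (-(mu * (t - a))) * mu)) / mu : ℝ)) a := by
        have : HasDerivAt (fun y => -(mu * (t - y))) mu a := by
          convert! (((hasDerivAt_id a).const_sub t).const_mul mu).neg using 1
          ring
        exact ((((this.exp).const_sub 1).div_const mu).ofReal_comp.const_mul _).add_const _
      have he : -(1 - meanWeight mu z w t s a) =
          (1 - z) * ((-(Real.exp (-(mu * (t - a))) * mu)) / mu : ℝ) := by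
        rw [meanWeight, if_pos h, neg_div, mul_div_cancel_right₀ _ hmu.ne']
        push_cast
        ring
      rw [he]
      refine hd.congr_of_eventuallyEq ?_
      filter_upwards [Iio_mem_nhds h] with y hy
      have hy : y < t := hy
      rw [deficit, max_eq_left (by linarith), max_eq_left (by linarith)]
      congr 3
      ring
    · rcases lt_or_gt_of_ne h2 with h' | h'
      · have hd : HasDerivAt (fun y => (1 - w) * (t + s - y : ℝ)) ((1 - w) * (-1 : ℝ)) a :=
          (((hasDerivAt_id a).const_sub (t + s)).ofReal_comp).const_mul _
        have he : -(1 - meanWeight mu z w t s a) = (1 - w) * (-1 : ℝ) := by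
          rw [meanWeight, if_neg h.not_gt, if_pos ⟨h, h'.le⟩]
          push_cast
          ring
        rw [he]
        refine hd.congr_of_eventuallyEq ?_
        filter_upwards [Ioo_mem_nhds h h'] with y hy
        rw [deficit, max_eq_right (by linarith [hy.1]), max_eq_left (by linarith [hy.2])]
        simp
      · have he : -(1 - meanWeight mu z w t s a) = 0 := by
          rw [meanWeight, if_neg h.not_gt, if_neg fun h => h'.not_ge h.2]
          simp
        rw [he]
        refine (hasDerivAt_const a (0 : ℂ)).congr_of_eventuallyEq ?_
        filter_upwards [Ioi_mem_nhds h'] with y hy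
        have hy : t + s < y := hy
        rw [deficit, max_eq_right (by linarith), max_eq_right (by linarith)]
        simp
  have h := ((key.const_mul (lam : ℂ)).fun_neg).cexp
  refine h.congr_deriv ?_
  rw [futureWeight]
  ring

theorem futureWeight_of_le (hs : 0 ≤ s) (h : t + s ≤ a) : futureWeight lam mu z w t s a = 1 := by
  rw [futureWeight, deficit, max_eq_right (by linarith), max_eq_right (by linarith)]
  simp

theorem norm_meanWeight_le (hmu : 0 < mu) (hz : ‖z‖ ≤ 1) (hw : ‖w‖ ≤ 1) (t s a : ℝ) :
    ‖meanWeight mu z w t s a‖ ≤ 1 := by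
  have := isProbabilityMeasure_expMeasure hmu
  rw [← integral_weight hmu]
  refine (norm_integral_le_of_norm_le_const (C := 1)
    (.of_forall fun σ => norm_weight_le hz hw t s a σ)).trans ?_
  simp

theorem measurable_meanWeight (mu : ℝ) (z w : ℂ) (t s : ℝ) :
    Measurable (meanWeight mu z w t s) := by
  unfold meanWeight
  refine Measurable.ite measurableSet_Iio (by fun_prop)
    (Measurable.ite (measurableSet_Ioi.inter measurableSet_Iic) measurable_const measurable_const)

/-- By the differential equation for H = `futureWeight`, the function -e^(-lam u) H(a+u) is a
primitive of the integrand lam e^(-lam u) m(a+u) H(a+u). It vanishes at infinity because |H| ≤ 1,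
and equals -H(a) at u = 0. -/
theorem integral_meanWeight_mul_futureWeight (hlam : 0 < lam) (hmu : 0 < mu) (hz : ‖z‖ ≤ 1)
    (hw : ‖w‖ ≤ 1) (hs : 0 ≤ s) (t a : ℝ) :
    ∫ u, meanWeight mu z w t s (a + u) * futureWeight lam mu z w t s (a + u) ∂(expMeasure lam) =
      futureWeight lam mu z w t s a := by
  rw [integral_expMeasure hlam]
  set f : ℝ → ℂ := fun u => (lam * Real.exp (-(lam * u))) •
    (meanWeight mu z w t s (a + u) * futureWeight lam mu z w t s (a + u)) with hf
  set F : ℝ → ℂ := fun u => -(Real.exp (-(lam * u)) * futureWeight lam mu z w t s (a + u)) with hF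
  have hHc : Continuous (futureWeight lam mu z w t s) := continuous_futureWeight lam mu z w t s
  have hFc : Continuous F := by fun_prop
  have hint : IntegrableOn f (Set.Ioi 0) := by
    have hb : IntegrableOn (fun u : ℝ => lam * Real.exp (-(lam * u))) (Set.Ioi 0) := by
      have := (exp_neg_integrableOn_Ioi 0 hlam).const_mul lam
      simp only [neg_mul] at this
      exact this
    refine Integrable.mono' hb ?_ (.of_forall fun u => ?_)
    · refine Measurable.aestronglyMeasurable ?_
      have h0 : Measurable fun u : ℝ => lam * Real.exp (-(lam * u)) := by fun_prop
      have h1 := (measurable_meanWeight mu z w t s).comp (measurable_const_add a)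
      have h2 := hHc.measurable.comp (measurable_const_add a)
      exact h0.smul (h1.mul h2)
    · rw [hf, norm_smul, Real.norm_of_nonneg (by positivity), norm_mul]
      exact mul_le_of_le_one_right (by positivity) (mul_le_one₀ (norm_meanWeight_le hmu hz hw _ _ _)
        (norm_nonneg _) (norm_futureWeight_le hlam hmu hz hw hs _ _))
  have hderiv : ∀ u, u ∉ ({t - a, t + s - a} : Set ℝ) → HasDerivAt F (f u) u := by
    intro u hu
    simp only [Set.mem_insert_iff, Set.mem_singleton_iff, not_or] at hu
    have h1 := (hasDerivAt_futureWeight (lam := lam) (mu := mu) (z := z) (w := w) (t := t) (s := s)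
      (a := a + u) hmu hs (fun h => hu.1 (by linarith)) (fun h => hu.2 (by linarith))).comp_const_add
      a u
    have h2 : HasDerivAt (fun u => Real.exp (-(lam * u))) (-(lam * Real.exp (-(lam * u)))) u := by
      have := (((hasDerivAt_id u).const_mul lam).neg).exp
      convert! this using 1
      simp; ring
    convert! (h2.ofReal_comp.mul h1).neg using 1
    rw [hf]
    simp only [Complex.real_smul]
    push_cast
    ring
  -- The fundamental theorem of calculus tolerates the two exceptional points because `F` is
  -- continuous there.
  have hI : ∀ R : ℝ, 0 ≤ R → ∫ u in (0 : ℝ)..R, f u = F R - F 0 := fun R hR =>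
    integral_eq_of_hasDerivAt_off_countable_of_le F f hR
      (s := {t - a, t + s - a}) (Set.Countable.insert _ (Set.countable_singleton _))
      hFc.continuousOn (fun x hx => hderiv x hx.2)
      ((intervalIntegrable_iff_integrableOn_Ioc_of_le hR).2
        (hint.mono_set Set.Ioc_subset_Ioi_self))
  have hlim1 := intervalIntegral_tendsto_integral_Ioi 0 hint Filter.tendsto_id
  have hF0 : Filter.Tendsto F Filter.atTop (nhds 0) := by
    have he : Filter.Tendsto (fun u : ℝ => Real.exp (-(lam * u))) Filter.atTop (nhds 0) :=
      Real.tendsto_exp_neg_atTop_nhds_zero.comp (Filter.tendsto_id.const_mul_atTop hlam)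
    refine squeeze_zero_norm (fun u => ?_) he
    rw [hF, norm_neg, norm_mul, Complex.norm_real, Real.norm_of_nonneg (Real.exp_pos _).le]
    exact mul_le_of_le_one_right (Real.exp_pos _).le (norm_futureWeight_le hlam hmu hz hw hs _ _)
  have hlim2 : Filter.Tendsto (fun R => ∫ u in (0 : ℝ)..R, f u) Filter.atTop (nhds (0 - F 0)) :=
    (hF0.sub_const _).congr' ((Filter.eventually_ge_atTop 0).mono fun R hR => (hI R hR).symm)
  rw [tendsto_nhds_unique hlim1 hlim2, hF]
  simp

theorem integral_weight_mul_futureWeight (hlam : 0 < lam) (hmu : 0 < mu) (hz : ‖z‖ ≤ 1)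
    (hw : ‖w‖ ≤ 1) (hs : 0 ≤ s) (t a : ℝ) :
    ∫ y : ℝ × ℝ, weight z w t s (a + y.1) y.2 * futureWeight lam mu z w t s (a + y.1)
      ∂((expMeasure lam).prod (expMeasure mu)) = futureWeight lam mu z w t s a := by
  have := isProbabilityMeasure_expMeasure hlam
  have := isProbabilityMeasure_expMeasure hmu
  rw [integral_prod]
  · simp only [integral_mul_const, integral_weight hmu]
    exact integral_meanWeight_mul_futureWeight hlam hmu hz hw hs t a
  · have h1 := (measurable_weight_comp z w t (measurable_const (a := s))
      (measurable_fst.const_add a) (measurable_snd (α := ℝ) (β := ℝ))).mul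
      (measurable_futureWeight_comp lam mu z w t (measurable_const (a := s))
        (measurable_fst.const_add a))
    refine Integrable.of_bound h1.aestronglyMeasurable 1 (.of_forall fun y => ?_)
    rw [norm_mul]
    exact mul_le_one₀ (norm_weight_le hz hw _ _ _ _) (norm_nonneg _)
      (norm_futureWeight_le hlam hmu hz hw hs _ _)

end MMInfty

/-! ### Pathwise counting of arrivals. -/

namespace MMInfty

section Paths

variable {Ω : Type*} {T S : ℕ → Ω → ℝ} {ω : Ω}

theorem monotone_arrivalTime (hT : ∀ j, 0 ≤ T j ω) : Monotone fun j => arrivalTime T j ω :=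
  monotone_nat_of_le_succ fun j => by
    simp only [arrivalTime]
    rw [Finset.sum_range_succ _ (j + 1)]
    linarith [hT (j + 1)]

/-- Monotone arrival times make the arrivals up to t an initial segment of ℕ. Divergence makes it
finite, which matters because `Set.ncard` is 0 on infinite sets. -/
theorem arrivalTime_le_iff (hT : ∀ j, 0 ≤ T j ω)
    (hA : Filter.Tendsto (fun j => arrivalTime T j ω) Filter.atTop Filter.atTop) (t : ℝ) (j : ℕ) :
    arrivalTime T j ω ≤ t ↔ j < arrivals T t ω := by
  classical
  have hex : ∃ j, t < arrivalTime T j ω := (hA.eventually_gt_atTop t).exists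
  have key : ∀ j, arrivalTime T j ω ≤ t ↔ j < Nat.find hex := by
    intro j
    constructor
    · intro h
      by_contra hlt
      exact absurd (Nat.find_spec hex)
        (not_lt.2 ((monotone_arrivalTime hT (not_lt.1 hlt)).trans h))
    · exact fun h => not_lt.1 (Nat.find_min hex h)
  have : arrivals T t ω = Nat.find hex := by
    have hset : {j : ℕ | arrivalTime T j ω ≤ t} = (Finset.range (Nat.find hex) : Set ℕ) := by
      ext j
      rw [Set.mem_ofPred_eq, key, Finset.mem_coe, Finset.mem_range]
    rw [arrivals, hset, Set.ncard_coe_finset, Finset.card_range]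
  rw [key, this]

/-- Replaces the random range of summation by any sufficiently large deterministic one, so that
limits in n apply. -/
theorem sum_range_eq_queueLength (hT : ∀ j, 0 ≤ T j ω)
    (hA : Filter.Tendsto (fun j => arrivalTime T j ω) Filter.atTop Filter.atTop) {t : ℝ} {n : ℕ}
    (hn : arrivals T t ω ≤ n) :
    (∑ j ∈ Finset.range n,
      if arrivalTime T j ω < t ∧ t < arrivalTime T j ω + S j ω then 1 else 0) =
      queueLength T S t ω := by
  rw [queueLength]
  refine (Finset.sum_subset (Finset.range_subset_range.2 hn) fun j _ hj => ?_).symm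
  rw [Finset.mem_range, ← arrivalTime_le_iff hT hA, not_le] at hj
  rw [if_neg fun h => hj.not_gt h.1]

theorem sum_range_eq_arrivals_sub (hT : ∀ j, 0 ≤ T j ω)
    (hA : Filter.Tendsto (fun j => arrivalTime T j ω) Filter.atTop Filter.atTop) {t s : ℝ} {n : ℕ}
    (hn : arrivals T (t + s) ω ≤ n) :
    (∑ j ∈ Finset.range n, if t < arrivalTime T j ω ∧ arrivalTime T j ω ≤ t + s then 1 else 0) =
      arrivals T (t + s) ω - arrivals T t ω := by
  rw [← Finset.card_filter, ← Nat.card_Ico]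
  congr 1
  ext j
  rw [Finset.mem_filter, Finset.mem_range, Finset.mem_Ico, arrivalTime_le_iff hT hA,
    ← not_le (a := arrivalTime T j ω), arrivalTime_le_iff hT hA]
  omega

theorem prod_weight (z w : ℂ) (t s : ℝ) (n : ℕ) :
    ∏ j ∈ Finset.range n, weight z w t s (arrivalTime T j ω) (S j ω) =
      z ^ (∑ j ∈ Finset.range n,
        if arrivalTime T j ω < t ∧ t < arrivalTime T j ω + S j ω then 1 else 0) *
      w ^ (∑ j ∈ Finset.range n,
        if t < arrivalTime T j ω ∧ arrivalTime T j ω ≤ t + s then 1 else 0) := by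
  rw [← Finset.prod_pow_eq_pow_sum, ← Finset.prod_pow_eq_pow_sum, ← Finset.prod_mul_distrib]
  refine Finset.prod_congr rfl fun j _ => ?_
  rw [weight]
  congr 1 <;> split_ifs <;> simp

end Paths

/-! ### The martingale over customers and the joint generating function. -/

section Law

variable {Ω : Type*}

/-- The product of the weights of the first `n` customers, the time of the last of their arrivals,
and the service time of the tagged customer. -/
noncomputable def state (T S : ℕ → Ω → ℝ) (S' : Ω → ℝ) (z w : ℂ) (t : ℝ) (n : ℕ) (ω : Ω) :
    ℂ × ℝ × ℝ :=
  (∏ j ∈ Finset.range n, weight z w t (S' ω) (arrivalTime T j ω) (S j ω),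
    ∑ i ∈ Finset.range n, T i ω, S' ω)

/-- The σ-algebra is arbitrary and only indices below n are constrained, so that the lemma also
applies to the σ-algebra generated by all variables except `T n` and `S n`. -/
theorem measurable_state {m : MeasurableSpace Ω} {T S : ℕ → Ω → ℝ} {S' : Ω → ℝ} {n : ℕ}
    (hT : ∀ i < n, Measurable (T i)) (hS : ∀ i < n, Measurable (S i)) (hS' : Measurable S')
    (z w : ℂ) (t : ℝ) : Measurable (state T S S' z w t n) := by
  refine Measurable.prodMk (Finset.measurable_fun_prod _ fun j hj => ?_)
    (Measurable.prodMk (Finset.measurable_fun_sum _ fun i hi => hT i (Finset.mem_range.1 hi)) hS')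
  have hj := Finset.mem_range.1 hj
  refine measurable_weight_comp z w t hS' (Finset.measurable_fun_sum _ fun i hi => hT i ?_) (hS j hj)
  have := Finset.mem_range.1 hi
  omega

variable [MeasurableSpace Ω] {P : Measure Ω} {lam mu : ℝ} {T S : ℕ → Ω → ℝ} {S' : Ω → ℝ}

/-- The two sides are measurable with respect to disjoint blocks of the independent family. The
tagged service time belongs to the past block, since every weight depends on it. -/
theorem IsQueue.indepFun_state (hQ : IsQueue P lam mu T S S') (z w : ℂ) (t : ℝ) (n : ℕ) :
    IndepFun (state T S S' z w t n) (fun ω => (T n ω, S n ω)) P := by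
  set f := Sum.elim T (Sum.elim S (fun _ : Unit => S')) with hf
  have hle : ∀ i, MeasurableSpace.comap (f i) inferInstance ≤ ‹MeasurableSpace Ω› := by
    rintro (i | i | i)
    · exact (hQ.measurable_interarrival i).comap_le
    · exact (hQ.measurable_service i).comap_le
    · exact hQ.measurable_tagged.comap_le
  set future : Set (ℕ ⊕ ℕ ⊕ Unit) := {Sum.inl n, Sum.inr (Sum.inl n)} with hfut
  have hind := indep_iSup_of_disjoint hle hQ.indep (disjoint_compl_left (a := future))
  have hmem : ∀ (A : Set (ℕ ⊕ ℕ ⊕ Unit)) (i), i ∈ A →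
      Measurable[⨆ i ∈ A, MeasurableSpace.comap (f i) inferInstance] (f i) := fun A i hi =>
    (comap_measurable (f i)).mono
      (le_iSup₂ (f := fun i (_ : i ∈ A) => MeasurableSpace.comap (f i) inferInstance) i hi) le_rfl
  refine indep_of_indep_of_le_left (indep_of_indep_of_le_right hind ?_) ?_
  · exact (Measurable.prodMk (hmem future (Sum.inl n) (by simp [hfut]))
      (hmem future (Sum.inr (Sum.inl n)) (by simp [hfut]))).comap_le
  · refine (measurable_state (fun i hi => hmem futureᶜ (Sum.inl i) ?_)
      (fun i hi => hmem futureᶜ (Sum.inr (Sum.inl i)) ?_)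
      (hmem futureᶜ (Sum.inr (Sum.inr ())) (by simp [hfut])) z w t).comap_le
    · simp [hfut, hi.ne]
    · simp [hfut, hi.ne]

theorem IsQueue.map_customer [IsProbabilityMeasure P] (hQ : IsQueue P lam mu T S S') (n : ℕ) :
    P.map (fun ω => (T n ω, S n ω)) = (expMeasure lam).prod (expMeasure mu) := by
  have h : IndepFun (T n) (S n) P :=
    hQ.indep.indepFun (i := Sum.inl n) (j := Sum.inr (Sum.inl n)) (by simp)
  rw [(indepFun_iff_map_prod_eq_prod_map_map (hQ.measurable_interarrival n).aemeasurable
    (hQ.measurable_service n).aemeasurable).1 h, (hQ.law_interarrival n).map_eq,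
    (hQ.law_service n).map_eq]

theorem IsQueue.ae_tagged_nonneg (hQ : IsQueue P lam mu T S S') (hmu : 0 < mu) :
    ∀ᵐ ω ∂P, 0 ≤ S' ω :=
  (hQ.law_tagged.ae_iff (p := fun x => 0 ≤ x) (by measurability)).2 (ae_nonneg_expMeasure hmu)

theorem IsQueue.ae_interarrival_nonneg (hQ : IsQueue P lam mu T S S') (hlam : 0 < lam) :
    ∀ᵐ ω ∂P, ∀ j, 0 ≤ T j ω :=
  ae_all_iff.2 fun j => ((hQ.law_interarrival j).ae_iff (p := fun x => 0 ≤ x) (by measurability)).2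
    (ae_nonneg_expMeasure hlam)

/-- By the second Borel–Cantelli lemma infinitely many interarrival times exceed 1, so their
nonnegative series diverges. -/
theorem IsQueue.ae_tendsto_arrivalTime [IsProbabilityMeasure P] (hQ : IsQueue P lam mu T S S')
    (hlam : 0 < lam) :
    ∀ᵐ ω ∂P, Filter.Tendsto (fun n => ∑ i ∈ Finset.range n, T i ω) Filter.atTop Filter.atTop := by
  have hm : ∀ n, MeasurableSet (T n ⁻¹' Set.Ioi 1) := fun n =>
    hQ.measurable_interarrival n measurableSet_Ioi
  have hind : iIndepFun T P := hQ.indep.precomp (g := Sum.inl) Sum.inl_injective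
  have hset : iIndepSet (fun n => T n ⁻¹' Set.Ioi 1) P :=
    (iIndepSet_iff_meas_biInter hm).2 fun s =>
      hind.measure_inter_preimage_eq_mul s fun _ _ => measurableSet_Ioi
  have := isProbabilityMeasure_expMeasure hlam
  have hP : ∀ n, P (T n ⁻¹' Set.Ioi 1) = expMeasure lam (Set.Ioi 1) := fun n => by
    rw [← (hQ.law_interarrival n).map_eq, Measure.map_apply (hQ.measurable_interarrival n)
      measurableSet_Ioi]
  have hne : expMeasure lam (Set.Ioi 1) ≠ 0 := fun h => by
    have h2 := measureReal_expMeasure_Ioi hlam zero_le_one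
    rw [measureReal_def, h] at h2
    exact (Real.exp_pos _).ne h2
  have hlim := measure_limsup_eq_one hm hset (by
    simp only [hP]
    exact ENNReal.tsum_const_eq_top_of_ne_zero hne)
  have hae := (mem_ae_iff_prob_eq_one (MeasurableSet.measurableSet_limsup hm)).2 hlim
  filter_upwards [hae, hQ.ae_interarrival_nonneg hlam] with ω hω hT
  rw [Filter.mem_limsup_iff_frequently_mem] at hω
  rw [← not_summable_iff_tendsto_nat_atTop_of_nonneg hT]
  intro hs
  have := hs.tendsto_atTop_zero.eventually (gt_mem_nhds one_pos)
  obtain ⟨n, h1, h2⟩ := (hω.and_eventually this).exists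
  have h1 : 1 < T n ω := h1
  exact h1.not_gt h2

/-- The martingale property: by independence and Fubini the past can be frozen while customer n is
integrated out, and the one-step identity collapses that inner integral to `futureWeight` at the
previous arrival. -/
theorem IsQueue.integral_state [IsProbabilityMeasure P] (hQ : IsQueue P lam mu T S S')
    (hlam : 0 < lam) (hmu : 0 < mu) {z w : ℂ} (hz : ‖z‖ ≤ 1) (hw : ‖w‖ ≤ 1) (t : ℝ) (n : ℕ) :
    ∫ ω, (state T S S' z w t n ω).1 * futureWeight lam mu z w t (S' ω)
      (∑ i ∈ Finset.range n, T i ω) ∂P = ∫ ω, futureWeight lam mu z w t (S' ω) 0 ∂P := by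
  induction n with
  | zero => simp [state]
  | succ n ih =>
    rw [← ih]
    set G : (ℂ × ℝ × ℝ) × (ℝ × ℝ) → ℂ := fun x =>
      x.1.1 * (weight z w t x.1.2.2 (x.1.2.1 + x.2.1) x.2.2 *
        futureWeight lam mu z w t x.1.2.2 (x.1.2.1 + x.2.1)) with hG
    set X := state T S S' z w t n with hX
    set Y : Ω → ℝ × ℝ := fun ω => (T n ω, S n ω) with hY
    have hXm : Measurable X := measurable_state (fun i _ => hQ.measurable_interarrival i)
      (fun i _ => hQ.measurable_service i) hQ.measurable_tagged z w t
    have hYm : Measurable Y := (hQ.measurable_interarrival n).prodMk (hQ.measurable_service n)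
    have hGm : Measurable G :=
      Measurable.mul (by fun_prop) ((measurable_weight_comp z w t (by fun_prop) (by fun_prop)
        (by fun_prop)).mul (measurable_futureWeight_comp lam mu z w t (by fun_prop) (by fun_prop)))
    have hmap : P.map (fun ω => (X ω, Y ω)) = (P.map X).prod (P.map Y) :=
      (indepFun_iff_map_prod_eq_prod_map_map hXm.aemeasurable hYm.aemeasurable).1
        (hQ.indepFun_state z w t n)
    -- Only almost sure, because the bound on `futureWeight` needs a nonnegative tagged service
    -- time.
    have hbound : ∀ᵐ ω ∂P, ‖G (X ω, Y ω)‖ ≤ 1 := by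
      filter_upwards [hQ.ae_tagged_nonneg hmu] with ω hω
      rw [hG, norm_mul, norm_mul]
      refine mul_le_one₀ ?_ (by positivity) (mul_le_one₀ (norm_weight_le hz hw _ _ _ _)
        (norm_nonneg _) (norm_futureWeight_le hlam hmu hz hw hω _ _))
      simp only [hX, state, norm_prod]
      exact Finset.prod_le_one (fun _ _ => norm_nonneg _) fun _ _ => norm_weight_le hz hw _ _ _ _
    have hint : Integrable G ((P.map X).prod (P.map Y)) := by
      rw [← hmap, integrable_map_measure hGm.aestronglyMeasurable (hXm.prodMk hYm).aemeasurable]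
      exact Integrable.of_bound (hGm.comp (hXm.prodMk hYm)).aestronglyMeasurable 1 hbound
    have hstep : ∀ ω, (state T S S' z w t (n + 1) ω).1 * futureWeight lam mu z w t (S' ω)
        (∑ i ∈ Finset.range (n + 1), T i ω) = G (X ω, Y ω) := by
      intro ω
      simp only [hG, hX, hY, state, Finset.prod_range_succ, arrivalTime, Finset.sum_range_succ]
      ring
    have : SFinite (P.map Y) := inferInstance
    calc _ = ∫ ω, G (X ω, Y ω) ∂P := by simp only [hstep]
      _ = ∫ x, G x ∂(P.map fun ω => (X ω, Y ω)) :=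
        (integral_map (hXm.prodMk hYm).aemeasurable hGm.aestronglyMeasurable).symm
      _ = ∫ x, ∫ y, G (x, y) ∂(P.map Y) ∂(P.map X) := by rw [hmap, integral_prod _ hint]
      _ = ∫ ω, ∫ y, G (X ω, y) ∂(P.map Y) ∂P :=
        integral_map hXm.aemeasurable
          hGm.stronglyMeasurable.integral_prod_right.aestronglyMeasurable
      _ = _ := by
        refine integral_congr_ae ?_
        filter_upwards [hQ.ae_tagged_nonneg hmu] with ω hω
        simp only [hG]
        rw [integral_const_mul, hY, hQ.map_customer]
        exact congrArg _ (integral_weight_mul_futureWeight hlam hmu hz hw hω t _)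

theorem IsQueue.ae_eventually_counts [IsProbabilityMeasure P] (hQ : IsQueue P lam mu T S S')
    (hlam : 0 < lam) (t : ℝ) :
    ∀ᵐ ω ∂P, ∀ᶠ n in Filter.atTop,
      (∑ j ∈ Finset.range n,
        if arrivalTime T j ω < t ∧ t < arrivalTime T j ω + S j ω then 1 else 0) =
          queueLength T S t ω ∧
      (∑ j ∈ Finset.range n,
        if t < arrivalTime T j ω ∧ arrivalTime T j ω ≤ t + S' ω then 1 else 0) =
          arrivals T (t + S' ω) ω - arrivals T t ω := by
  filter_upwards [hQ.ae_interarrival_nonneg hlam, hQ.ae_tendsto_arrivalTime hlam] with ω hT hA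
  have hA' : Filter.Tendsto (fun j => arrivalTime T j ω) Filter.atTop Filter.atTop :=
    hA.comp (Filter.tendsto_add_atTop_nat 1)
  filter_upwards [Filter.eventually_ge_atTop (arrivals T t ω),
    Filter.eventually_ge_atTop (arrivals T (t + S' ω) ω)] with n h1 h2
  exact ⟨sum_range_eq_queueLength hT hA' h1, sum_range_eq_arrivals_sub hT hA' h2⟩

theorem measurable_arrivalTime (hT : ∀ j, Measurable (T j)) (j : ℕ) :
    Measurable (arrivalTime T j) :=
  Finset.measurable_fun_sum _ fun i _ => hT i

theorem IsQueue.aemeasurable_queueLength [IsProbabilityMeasure P] (hQ : IsQueue P lam mu T S S')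
    (hlam : 0 < lam) (t : ℝ) : AEMeasurable (queueLength T S t) P := by
  have hA := measurable_arrivalTime hQ.measurable_interarrival
  refine aemeasurable_of_tendsto_metrizable_ae Filter.atTop (f := fun n ω => ∑ j ∈ Finset.range n,
    if arrivalTime T j ω < t ∧ t < arrivalTime T j ω + S j ω then 1 else 0) (fun n => ?_) ?_
  · refine (Finset.measurable_fun_sum _ fun j _ => Measurable.ite ?_ measurable_const
      measurable_const).aemeasurable
    exact (measurableSet_lt (hA j) measurable_const).inter
      (measurableSet_lt measurable_const ((hA j).add (hQ.measurable_service j)))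
  · filter_upwards [hQ.ae_eventually_counts hlam t] with ω hω
    exact tendsto_nhds_of_eventually_eq (hω.mono fun n h => h.1)

theorem IsQueue.aemeasurable_arrivals_sub [IsProbabilityMeasure P] (hQ : IsQueue P lam mu T S S')
    (hlam : 0 < lam) (t : ℝ) :
    AEMeasurable (fun ω => arrivals T (t + S' ω) ω - arrivals T t ω) P := by
  have hA := measurable_arrivalTime hQ.measurable_interarrival
  refine aemeasurable_of_tendsto_metrizable_ae Filter.atTop (f := fun n ω => ∑ j ∈ Finset.range n,
    if t < arrivalTime T j ω ∧ arrivalTime T j ω ≤ t + S' ω then 1 else 0) (fun n => ?_) ?_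
  · refine (Finset.measurable_fun_sum _ fun j _ => Measurable.ite ?_ measurable_const
      measurable_const).aemeasurable
    exact (measurableSet_lt measurable_const (hA j)).inter
      (measurableSet_le (hA j) (measurable_const.add hQ.measurable_tagged))
  · filter_upwards [hQ.ae_eventually_counts hlam t] with ω hω
    exact tendsto_nhds_of_eventually_eq (hω.mono fun n h => h.2)

theorem IsQueue.aemeasurable_overlap [IsProbabilityMeasure P] (hQ : IsQueue P lam mu T S S')
    (hlam : 0 < lam) (t : ℝ) : AEMeasurable (overlap T S S' t) P :=
  (hQ.aemeasurable_arrivals_sub hlam t).add (hQ.aemeasurable_queueLength hlam t)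

/-- The joint probability generating function of `Q(t)` and `N(t + S') - N(t)`. -/
theorem IsQueue.integral_pow_mul_pow [IsProbabilityMeasure P] (hQ : IsQueue P lam mu T S S')
    (hlam : 0 < lam) (hmu : 0 < mu) {z w : ℂ} (hz : ‖z‖ ≤ 1) (hw : ‖w‖ ≤ 1) {t : ℝ}
    (ht : 0 ≤ t) :
    ∫ ω, z ^ queueLength T S t ω * w ^ (arrivals T (t + S' ω) ω - arrivals T t ω) ∂P =
      Complex.exp ((lam / mu * (1 - Real.exp (-(mu * t))) : ℝ) * (z - 1)) *
        (mu / (mu + lam * (1 - w))) := by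
  have hlim : Filter.Tendsto (fun n => ∫ ω, (state T S S' z w t n ω).1 *
      futureWeight lam mu z w t (S' ω) (∑ i ∈ Finset.range n, T i ω) ∂P) Filter.atTop
      (nhds (∫ ω, z ^ queueLength T S t ω *
        w ^ (arrivals T (t + S' ω) ω - arrivals T t ω) ∂P)) := by
    refine tendsto_integral_of_dominated_convergence (fun _ => 1) (fun n => ?_)
      (integrable_const _) (fun n => ?_) ?_
    · exact ((measurable_state (fun i _ => hQ.measurable_interarrival i)
        (fun i _ => hQ.measurable_service i) hQ.measurable_tagged z w t).fst.mul
        (measurable_futureWeight_comp lam mu z w t hQ.measurable_tagged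
          (Finset.measurable_fun_sum _ fun i _ => hQ.measurable_interarrival i))).aestronglyMeasurable
    · filter_upwards [hQ.ae_tagged_nonneg hmu] with ω hω
      rw [norm_mul]
      refine mul_le_one₀ ?_ (norm_nonneg _) (norm_futureWeight_le hlam hmu hz hw hω _ _)
      simp only [state, norm_prod]
      exact Finset.prod_le_one (fun _ _ => norm_nonneg _) fun _ _ => norm_weight_le hz hw _ _ _ _
    · filter_upwards [hQ.ae_tagged_nonneg hmu, hQ.ae_tendsto_arrivalTime hlam,
        hQ.ae_eventually_counts hlam t] with ω hs hA hω
      refine tendsto_nhds_of_eventually_eq ?_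
      filter_upwards [hω, hA.eventually_ge_atTop (t + S' ω)] with n h1 h2
      rw [futureWeight_of_le hs h2, mul_one, state, prod_weight, h1.1, h1.2]
  -- The integrals do not depend on n, so their limit is their common value E[H(0)].
  rw [tendsto_nhds_unique hlim ((Filter.tendsto_congr fun n =>
    hQ.integral_state hlam hmu hz hw t n).2 tendsto_const_nhds)]
  have hfac : ∀ s : ℝ, 0 ≤ s → futureWeight lam mu z w t s 0 =
      Complex.exp ((lam / mu * (1 - Real.exp (-(mu * t))) : ℝ) * (z - 1)) *
        Complex.exp (-(lam * (1 - w) * s)) := by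
    intro s hs
    rw [futureWeight, deficit, sub_zero, sub_zero, max_eq_left ht, max_eq_left (by linarith),
      ← Complex.exp_add]
    congr 1
    push_cast
    ring
  have hint := hQ.law_tagged.integral_comp (f := fun s : ℝ => Complex.exp (-(lam * (1 - w) * s)))
    (by fun_prop)
  rw [integral_cexp_neg_mul_expMeasure hmu (by
    rw [Complex.re_ofReal_mul]; exact mul_nonneg hlam.le (one_sub_re_nonneg hw))] at hint
  rw [← hint, ← integral_const_mul]
  exact integral_congr_ae ((hQ.ae_tagged_nonneg hmu).mono fun ω hω => hfac _ hω)

end Law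

end MMInfty

/-! ### Identification of the laws of Q(t) and O(t) through characteristic functions. -/

theorem MeasureTheory.Measure.ext_nat_of_charFun {α β : Measure ℕ} [IsFiniteMeasure α]
    [IsFiniteMeasure β]
    (h : ∀ θ : ℝ, charFun (α.map (Nat.cast : ℕ → ℝ)) θ = charFun (β.map (Nat.cast : ℕ → ℝ)) θ) :
    α = β := by
  apply (MeasurableEmbedding.natCast (α := ℝ)).map_injective
  exact Measure.ext_of_charFun (funext h)

namespace MMInfty

variable {Ω : Type*} [MeasurableSpace Ω] {P : Measure Ω} {lam mu : ℝ}
  {T S : ℕ → Ω → ℝ} {S' : Ω → ℝ}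

theorem charFun_map_natCast_map {X : Ω → ℕ} (hX : AEMeasurable X P) (θ : ℝ) :
    charFun ((P.map X).map (Nat.cast : ℕ → ℝ)) θ =
      ∫ ω, Complex.exp (θ * Complex.I) ^ X ω ∂P := by
  rw [charFun_apply_real, integral_map (by fun_prop) (by fun_prop),
    integral_map hX (by fun_prop)]
  refine integral_congr_ae (.of_forall fun ω => ?_)
  simp only
  rw [← Complex.exp_nat_mul]
  congr 1
  push_cast
  ring

theorem IsQueue.hasLaw_queueLength [IsProbabilityMeasure P]
    (hQ : IsQueue P lam mu T S S') (hlam : 0 < lam) (hmu : 0 < mu)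
    {t : ℝ} (ht : 0 ≤ t) :
    HasLaw (queueLength T S t)
      (poissonMeasure (lam / mu * (1 - Real.exp (-(mu * t)))).toNNReal) P := by
  have hq : 0 ≤ lam / mu * (1 - Real.exp (-(mu * t))) :=
    mul_nonneg (by positivity) (sub_nonneg.2 (Real.exp_le_one_iff.2 (by
      rw [neg_nonpos]; positivity)))
  have hX := hQ.aemeasurable_queueLength hlam t
  have := Measure.isProbabilityMeasure_map hX
  refine ⟨hX, Measure.ext_nat_of_charFun fun θ => ?_⟩
  rw [charFun_map_natCast_map hX, charFun_map_cast_poissonMeasure, Real.coe_toNNReal _ hq]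
  -- Setting w = 1 removes the arrivals after t and leaves the Poisson factor.
  have h := hQ.integral_pow_mul_pow hlam hmu (z := Complex.exp (θ * Complex.I)) (w := 1)
    (Complex.norm_exp_ofReal_mul_I θ).le (by simp) ht
  have hmu' : (mu : ℂ) ≠ 0 := by exact_mod_cast hmu.ne'
  simpa [hmu'] using h

theorem IsQueue.hasLaw_overlap [IsProbabilityMeasure P]
    (hQ : IsQueue P lam mu T S S') (hlam : 0 < lam) (hmu : 0 < mu)
    {t : ℝ} (ht : 0 ≤ t) :
    HasLaw (overlap T S S' t) (geometricLaw (ratio hlam hmu) ∗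
      poissonMeasure (lam / mu * (1 - Real.exp (-(mu * t)))).toNNReal) P := by
  have hq : 0 ≤ lam / mu * (1 - Real.exp (-(mu * t))) :=
    mul_nonneg (by positivity) (sub_nonneg.2 (Real.exp_le_one_iff.2 (by
      rw [neg_nonpos]; positivity)))
  have hX := hQ.aemeasurable_overlap hlam t
  have := Measure.isProbabilityMeasure_map hX
  have hs : ((unitInterval.symm (ratio hlam hmu) : unitInterval) : ℝ) = 1 - lam / (lam + mu) := rfl
  refine ⟨hX, ?_⟩
  rw [geometricLaw]
  refine Measure.ext_nat_of_charFun fun θ => ?_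
  rw [charFun_map_natCast_map hX, ← Nat.coe_castAddMonoidHom,
    Measure.map_conv_addMonoidHom _ (by fun_prop), charFun_conv, Nat.coe_castAddMonoidHom,
    charFun_map_cast_geometricMeasure (symm_ratio_ne_zero hlam hmu),
    charFun_map_cast_poissonMeasure, Real.coe_toNNReal _ hq, hs,
    mul_comm ((_ : ℂ) / _)]
  have hz := (Complex.norm_exp_ofReal_mul_I θ).le
  have h := hQ.integral_pow_mul_pow hlam hmu hz hz ht
  simp only [overlap, pow_add]
  -- With z = w = e^(iθ) the Poisson factors on both sides agree; it remains to match mu/(mu +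
  -- lam(1-w)) with (1-ρ)/(1-ρw).
  rw [integral_congr_ae (.of_forall fun ω => mul_comm _ _), h]
  congr 1
  have hne : (mu + lam * (1 - Complex.exp (θ * Complex.I)) : ℂ) ≠ 0 := fun h0 => by
    have h1 := congrArg Complex.re h0
    rw [Complex.add_re, Complex.re_ofReal_mul, Complex.ofReal_re, Complex.zero_re] at h1
    have := mul_nonneg hlam.le (one_sub_re_nonneg hz)
    linarith
  have hlm : (lam + mu : ℂ) ≠ 0 := by exact_mod_cast (by positivity : lam + mu ≠ 0)
  have he : (1 - (1 - ((1 - lam / (lam + mu) : ℝ) : ℂ)) * Complex.exp (θ * Complex.I)) =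
      (mu + lam * (1 - Complex.exp (θ * Complex.I))) / (lam + mu) := by
    push_cast
    field_simp
    ring
  rw [he]
  push_cast
  field_simp
  ring

end MMInfty

/-! ### Transfer of mass function and moments from the convolution to O(t). -/

theorem mainTheorem4 {Ω : Type*} [MeasurableSpace Ω] (P : Measure Ω) [IsProbabilityMeasure P]
    (lam mu : ℝ) (hlam : 0 < lam) (hmu : 0 < mu)
    (T S : ℕ → Ω → ℝ) (S' : Ω → ℝ) (hQ : MMInfty.IsQueue P lam mu T S S')
    (t : ℝ) (ht : 0 ≤ t) :
    -- the mean queue length `q(t)` is a genuine expectation, with its explicit value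
    (Integrable (fun ω => (MMInfty.queueLength T S t ω : ℝ)) P ∧
      MMInfty.meanQueueLength P T S t = lam / mu * (1 - Real.exp (-(mu * t)))) ∧
    -- the distribution of `O(t)`
    (∀ k : ℕ, P.real {ω | MMInfty.overlap T S S' t ω = k} =
      (lam / (lam + mu)) ^ k * (1 - lam / (lam + mu)) *
        Real.exp (mu / lam * MMInfty.meanQueueLength P T S t) *
        (MMInfty.upperGamma ((k : ℝ) + 1)
            ((lam + mu) / lam * MMInfty.meanQueueLength P T S t) /
          Real.Gamma ((k : ℝ) + 1))) ∧
    -- mean and variance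
    MemLp (fun ω => (MMInfty.overlap T S S' t ω : ℝ)) 2 P ∧
    (∫ ω, (MMInfty.overlap T S S' t ω : ℝ) ∂P) = lam / mu * (2 - Real.exp (-(mu * t))) ∧
    variance (fun ω => (MMInfty.overlap T S S' t ω : ℝ)) P =
      lam ^ 2 / mu ^ 2 + lam / mu * (2 - Real.exp (-(mu * t))) ∧
    -- `O(t)` is distributed as a geometric plus an independent Poisson variable
    HasLaw (MMInfty.overlap T S S' t)
      (MMInfty.geometricLaw (MMInfty.ratio hlam hmu) ∗
        poissonMeasure (MMInfty.meanQueueLength P T S t).toNNReal) P := by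
  have hlawQ := hQ.hasLaw_queueLength hlam hmu ht
  have hlawO := hQ.hasLaw_overlap hlam hmu ht
  set q := lam / mu * (1 - Real.exp (-(mu * t))) with hqdef
  have hq : 0 ≤ q :=
    mul_nonneg (by positivity) (sub_nonneg.2 (Real.exp_le_one_iff.2 (by
      rw [neg_nonpos]; positivity)))
  obtain ⟨hp2, hpm, hpv⟩ := poissonMeasure_memLp_mean_variance q.toNNReal
  obtain ⟨hg2, hgm, hgv⟩ := geometricMeasure_memLp_mean_variance
    (MMInfty.symm_ratio_ne_zero hlam hmu)
  obtain ⟨hc2, hcm, hcv⟩ := conv_nat_memLp_mean_variance hg2 hp2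
  have hs : (1 - ((unitInterval.symm (MMInfty.ratio hlam hmu) : unitInterval) : ℝ)) /
      (unitInterval.symm (MMInfty.ratio hlam hmu) : unitInterval) = lam / mu := by
    have : ((unitInterval.symm (MMInfty.ratio hlam hmu) : unitInterval) : ℝ) =
      mu / (lam + mu) := by
      change 1 - lam / (lam + mu) = _
      field_simp
      ring
    rw [this]
    field_simp
    ring
  rw [hpm, hgm, hs, Real.coe_toNNReal q hq] at hcm
  rw [hpv, hgv, hs, Real.coe_toNNReal q hq] at hcv
  have hmean : MMInfty.meanQueueLength P T S t = q := by
    rw [MMInfty.meanQueueLength, ← Real.coe_toNNReal q hq, ← hpm]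
    exact hlawQ.integral_comp (f := fun n : ℕ => (n : ℝ)) (by fun_prop)
  have hQint : Integrable (fun ω => (MMInfty.queueLength T S t ω : ℝ)) P := by
    have := hp2.integrable (by norm_num)
    rw [← hlawQ.map_eq] at this
    exact this.comp_aemeasurable hlawQ.aemeasurable
  have hOL : MemLp (fun ω => (MMInfty.overlap T S S' t ω : ℝ)) 2 P := by
    have := hc2
    rw [← MMInfty.geometricLaw, ← hlawO.map_eq,
      memLp_map_measure_iff (by fun_prop) hlawO.aemeasurable] at this
    exact this
  have hOm : ∫ ω, (MMInfty.overlap T S S' t ω : ℝ) ∂P = lam / mu + q := by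
    rw [← hcm]
    exact hlawO.integral_comp (f := fun n : ℕ => (n : ℝ)) (by fun_prop)
  have hOv : variance (fun ω => (MMInfty.overlap T S S' t ω : ℝ)) P =
      (lam / mu) ^ 2 + lam / mu + q := by
    rw [← hcv, ← MMInfty.geometricLaw, ← hlawO.map_eq,
      variance_map (by fun_prop) hlawO.aemeasurable]
    rfl
  rw [hmean]
  refine ⟨⟨hQint, rfl⟩, fun k => ?_, hOL, ?_, ?_, hlawO⟩
  · rw [← geometric_conv_poisson_real_singleton hlam hmu hq k]
    exact hlawO.measureReal_eq (p := fun n => n = k) (.of_discrete)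
  · rw [hOm, hqdef]
    ring
  · rw [hOv, hqdef]
    ring
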